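/- Let $K$ be a field, $n\ge 0$, $A=(a_{i,j})_{1\le i,j\le n}$ an $n\times n$ matrix over $K$ with non-zero entries, and $\lambda=(\lambda_a)_{a\in\mathbb Z}$, $\mu=(\mu_a)_{a\in\mathbb Z}$ sequences in $K$. Let $(s^{\pm1}\lambda)_a=\lambda_{a\pm1}$, and let $A_{i_1,\dots,i_k}^{j_1,\dots,j_k}$ be $A$ with rows $i_1,\dots,i_k$ and columns $j_1,\dots,j_k$ erased. Define the generalized Lambda-determinant $|A|_{\lambda,\mu}$ as follows: the $0\times0$ matrix has value $1$, the $1\times1$ matrix $(a)$ has value $a$, and for $n\ge2$ $$|A|_{\lambda,\mu}=\frac{\mu_0\,|A_1^1|_{\lambda,s\mu}\,|A_n^n|_{\lambda,s^{-1}\mu}+\lambda_0\,|A_1^n|_{s^{-1}\lambda,\mu}\,|A_n^1|_{s\lambda,\mu}}{|A_{1,n}^{1,n}|_{\lambda,\mu}} .$$ Let $H$ be the space of formal combinations $\sum_{x,y}f(x,y)|x,y\rangle$ over $K$, $(x,y)\in\mathbb Z^2$, whose support is bounded below in $x$, with canonical basis vectors $|x,y\rangle$ and dual basis $\langle x,y|$.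 Let $\alpha:\mathbb Z^2\to K\setminus\{0\}$ be any function with $$\alpha_{x,y}=a_{\frac{x-y}2+n,\frac{x+y}2+1}\quad\text{on}\quad \mathcal D_n=\{(x,y)\in\mathbb Z^2: x+y\equiv0 \bmod 2,\ |x|+|y-n+1|\le n-1\}.$$ Let $\hat w|x,y\rangle=|x+1,y+1\rangle$, $\hat z|x,y\rangle=|x+1,y-1\rangle$, $\hat\alpha|x,y\rangle=\alpha_{x,y}|x,y\rangle$, $\hat\ell|x,y\rangle=\lambda_{y+1-n}|x,y\rangle$, $\hat m|x,y\rangle=\mu_x|x,y\rangle$, and $$T=\hat w\hat\ell+\hat w\hat m\hat\alpha^{-1}\hat z\hat\alpha+\hat\alpha^{-1}\hat z\hat\alpha .$$ Then: (1) $I-T$ is invertible on $H$. (2) Consider the directed network with vertex set $\mathcal D_n$ and the following edges between its vertices: $(x,y)\to(x+1,y+1)$ with weight $\lambda_{y+1-n}$, $(x,y)\to(x+2,y)$ with weight $\mu_{x+1}\alpha_{x,y}/\alpha_{x+1,y-1}$, and $(x,y)\to(x+1,y-1)$ with weight $\alpha_{x,y}/\alpha_{x+1,y-1}$. For $1\le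 i,j\le n$ let $Z_{i,j}$ be the sum, over the finitely many directed paths from $(1-i,i-1)$ to $(j-1,j-1)$, of the product of the weights of the traversed edges. Then $$Z_{i,j}=\langle0,0|\,\hat w^{1-j}(I-T)^{-1}\hat z^{1-i}\,|0,0\rangle .$$ (3) Whenever the recursive definition of $|A|_{\lambda,\mu}$ makes sense, i.e. no division by zero occurs in it, $$|A|_{\lambda,\mu}=\det_{1\le i,j\le n}\ \langle0,0|\,\hat w^{1-j}\,\hat\alpha\,\big(I-\hat w\hat\ell-\hat w\hat m\hat\alpha^{-1}\hat z\hat\alpha-\hat\alpha^{-1}\hat z\hat\alpha\big)^{-1}\hat z^{1-i}\,|0,0\rangle .$$ (4) In all cases, the Lambda-determinant of the matrix of indeterminates with indeterminate parameters, a rational function over $\mathbb Z$ in the $a_{i,j},\lambda_a,\mu_a$, is regular at the given point $(A,\lambda,\mu)$, and its value there is the determinant of part (3). -/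

import Mathlib

/-! ### The generalized Lambda-determinant -/

/-- The generalized Lambda-determinant of `A` with parameter sequences `lam`, `mu`, by the
inhomogeneous Dodgson condensation recursion. Erasing the first row or column is `Fin.succ`, erasing the last one is `Fin.castSucc`;
the sequence `fun a => mu (a + 1)` is the shift `s mu` and `fun a => mu (a - 1)` is `s⁻¹ mu`. -/
def lambdaDet {K : Type*} [Field K] :
    (n : ℕ) → (lam mu : ℤ → K) → Matrix (Fin n) (Fin n) K → K
  | 0, _, _, _ => 1
  | 1, _, _, A => A 0 0
  | n + 2, lam, mu, A =>
    (mu 0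
        * lambdaDet (n + 1) lam (fun a => mu (a + 1)) (A.submatrix Fin.succ Fin.succ)
        * lambdaDet (n + 1) lam (fun a => mu (a - 1)) (A.submatrix Fin.castSucc Fin.castSucc)
      + lam 0
        * lambdaDet (n + 1) (fun a => lam (a - 1)) mu (A.submatrix Fin.succ Fin.castSucc)
        * lambdaDet (n + 1) (fun a => lam (a + 1)) mu (A.submatrix Fin.castSucc Fin.succ))
      / lambdaDet n lam mu
          (A.submatrix (fun i => i.castSucc.succ) (fun i => i.castSucc.succ))

/-- The condensation recursion for `A` never divides by zero. -/
def CondensationDefined {K : Type*} [Field K] :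
    (n : ℕ) → (lam mu : ℤ → K) → Matrix (Fin n) (Fin n) K → Prop
  | 0, _, _, _ => True
  | 1, _, _, _ => True
  | n + 2, lam, mu, A =>
    CondensationDefined (n + 1) lam (fun a => mu (a + 1)) (A.submatrix Fin.succ Fin.succ) ∧
    CondensationDefined (n + 1) lam (fun a => mu (a - 1))
      (A.submatrix Fin.castSucc Fin.castSucc) ∧
    CondensationDefined (n + 1) (fun a => lam (a - 1)) mu
      (A.submatrix Fin.succ Fin.castSucc) ∧
    CondensationDefined (n + 1) (fun a => lam (a + 1)) mu
      (A.submatrix Fin.castSucc Fin.succ) ∧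
    CondensationDefined n lam mu
      (A.submatrix (fun i => i.castSucc.succ) (fun i => i.castSucc.succ)) ∧
    lambdaDet n lam mu
      (A.submatrix (fun i => i.castSucc.succ) (fun i => i.castSucc.succ)) ≠ 0

/-- Indeterminates: the entries of an `n × n` matrix, the `λ_a` and the `μ_a`, `a ∈ ℤ`. -/
abbrev LambdaVar (n : ℕ) : Type := (Fin n × Fin n) ⊕ (ℤ ⊕ ℤ)

/-- The field of rational functions over `ℚ` in these indeterminates, presented as the fraction
field of the polynomial ring with integer coefficients. -/
abbrev LambdaField (n : ℕ) : Type := FractionRing (MvPolynomial (LambdaVar n) ℤ)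

/-- The Lambda-determinant of the matrix of indeterminates, with indeterminate parameters. -/
noncomputable def genericLambdaDet (n : ℕ) : LambdaField n :=
  lambdaDet n
    (fun a => algebraMap (MvPolynomial (LambdaVar n) ℤ) (LambdaField n)
      (MvPolynomial.X (Sum.inr (Sum.inl a))))
    (fun a => algebraMap (MvPolynomial (LambdaVar n) ℤ) (LambdaField n)
      (MvPolynomial.X (Sum.inr (Sum.inr a))))
    (Matrix.of fun i j => algebraMap (MvPolynomial (LambdaVar n) ℤ) (LambdaField n)
      (MvPolynomial.X (Sum.inl (i, j))))

/-- The rational function `f` is regular at the point `p`, with value `d` there. -/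
def HasValueAt {σ K : Type*} [Field K] (f : FractionRing (MvPolynomial σ ℤ)) (p : σ → K)
    (d : K) : Prop :=
  ∃ N D : MvPolynomial σ ℤ, MvPolynomial.aeval p D ≠ 0 ∧
    f * algebraMap (MvPolynomial σ ℤ) (FractionRing (MvPolynomial σ ℤ)) D =
      algebraMap (MvPolynomial σ ℤ) (FractionRing (MvPolynomial σ ℤ)) N ∧
    d * MvPolynomial.aeval p D = MvPolynomial.aeval p N

/-- The point with coordinates the entries of `A` and the given parameters. -/
def lambdaPoint {K : Type*} (n : ℕ) (lam mu : ℤ → K) (A : Matrix (Fin n) (Fin n) K) :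
    LambdaVar n → K :=
  Sum.elim (fun v => A v.1 v.2) (Sum.elim lam mu)

/-! ### The space `H` and its operators -/

/-- The space `H` with canonical basis `|x,y⟩`, `(x,y) ∈ ℤ²`, completed so that `(I - T)⁻¹` makes
sense: `f` stands for the formal combination `∑ f (x,y) |x,y⟩`, and the combinations allowed are
those whose support is bounded below in the `x` direction. -/
def LatticeSpace (K : Type*) [Field K] : Submodule K (ℤ × ℤ → K) where
  carrier := {f | ∃ N : ℤ, ∀ v : ℤ × ℤ, v.1 < N → f v = 0}
  add_mem' := by
    rintro f g ⟨N, hN⟩ ⟨M, hM⟩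
    refine ⟨min N M, fun v hv => ?_⟩
    simp [hN v (lt_of_lt_of_le hv (min_le_left _ _)), hM v (lt_of_lt_of_le hv (min_le_right _ _))]
  zero_mem' := ⟨0, fun _ _ => rfl⟩
  smul_mem' := by
    rintro c f ⟨N, hN⟩
    exact ⟨N, fun v hv => by simp [hN v hv]⟩

/-- The basis vector `|v⟩`. -/
def ket (K : Type*) [Field K] (v : ℤ × ℤ) : LatticeSpace K :=
  ⟨Pi.single v 1, v.1, fun u hu => Pi.single_eq_of_ne (fun h => by simp [h] at hu) 1⟩

/-- The dual basis vector `⟨v|`, that is the coordinate of index `v`. -/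
def bra (K : Type*) [Field K] (v : ℤ × ℤ) : LatticeSpace K →ₗ[K] K :=
  (LinearMap.proj v).comp (LatticeSpace K).subtype

/-- The translation operator `|v⟩ ↦ |v + d⟩`. -/
def latticeTranslate (K : Type*) [Field K] (d : ℤ × ℤ) : LatticeSpace K ≃ₗ[K] LatticeSpace K where
  toFun f := ⟨fun v => f.1 (v - d), by
    obtain ⟨N, hN⟩ := f.2
    exact ⟨N + d.1, fun v hv => hN _ (by simp only [Prod.fst_sub]; omega)⟩⟩
  map_add' _ _ := rfl
  map_smul' _ _ := rfl
  invFun f := ⟨fun v => f.1 (v + d), by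
    obtain ⟨N, hN⟩ := f.2
    exact ⟨N - d.1, fun v hv => hN _ (by simp only [Prod.fst_add]; omega)⟩⟩
  left_inv f := by ext v; simp
  right_inv f := by ext v; simp

/-- The operator `ŵ : |x,y⟩ ↦ |x+1,y+1⟩`. -/
def wOp (K : Type*) [Field K] : LatticeSpace K ≃ₗ[K] LatticeSpace K := latticeTranslate K (1, 1)

/-- The operator `ẑ : |x,y⟩ ↦ |x+1,y-1⟩`. -/
def zOp (K : Type*) [Field K] : LatticeSpace K ≃ₗ[K] LatticeSpace K := latticeTranslate K (1, -1)

/-- The diagonal operator `|v⟩ ↦ c v |v⟩`. -/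
def diagOp {K : Type*} [Field K] (c : ℤ × ℤ → K) : Module.End K (LatticeSpace K) where
  toFun f := ⟨fun v => c v * f.1 v, by
    obtain ⟨N, hN⟩ := f.2
    exact ⟨N, fun v hv => by simp [hN v hv]⟩⟩
  map_add' f g := by ext v; simp [mul_add]
  map_smul' r f := by ext v; simp [mul_left_comm]

/-- The transfer operator `T = ŵ ℓ̂ + ŵ m̂ α̂⁻¹ ẑ α̂ + α̂⁻¹ ẑ α̂`, where `ℓ_{x,y} = λ_{y+1-n}` and
`m_{x,y} = μ_x`; it is used for a nowhere vanishing function `α`. -/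
def transferOp {K : Type*} [Field K] (n : ℕ) (lam mu : ℤ → K) (α : ℤ × ℤ → K) :
    Module.End K (LatticeSpace K) :=
  let w : Module.End K (LatticeSpace K) := (wOp K).toLinearMap
  let z : Module.End K (LatticeSpace K) := (zOp K).toLinearMap
  let l : Module.End K (LatticeSpace K) := diagOp fun v => lam (v.2 + 1 - n)
  let m : Module.End K (LatticeSpace K) := diagOp fun v => mu v.1
  let a : Module.End K (LatticeSpace K) := diagOp α
  let aInv : Module.End K (LatticeSpace K) := diagOp fun v => (α v)⁻¹
  w * l + w * m * aInv * z * a + aInv * z * a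

/-! ### The network and its path partition functions -/

/-- The vertex set
`𝒟_n = {(x,y) ∈ ℤ² : x + y = 0 mod 2, |x| + |y - n + 1| ≤ n - 1}`. -/
def networkVertices (n : ℕ) : Set (ℤ × ℤ) :=
  {v | Even (v.1 + v.2) ∧ |v.1| + |v.2 - n + 1| ≤ (n : ℤ) - 1}

/-- The three kinds of directed edges of the triangular lattice. -/
inductive NetStep : Type
  | up
  | flat
  | down

/-- The displacement along an edge. -/
def NetStep.disp : NetStep → ℤ × ℤ
  | .up => (1, 1)
  | .flat => (2, 0)
  | .down => (1, -1)

/-- The weight of the edge of the given kind that starts at `v`. -/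
def NetStep.weight {K : Type*} [Field K] (n : ℕ) (lam mu : ℤ → K) (α : ℤ × ℤ → K)
    (v : ℤ × ℤ) : NetStep → K
  | .up => lam (v.2 + 1 - n)
  | .flat => mu (v.1 + 1) * (α v / α (v + (1, -1)))
  | .down => α v / α (v + (1, -1))

/-- `IsNetPath n u e p`: the sequence of steps `p` leads from `u` to `e`, and all the vertices
visited, `u` and `e` included, lie in `networkVertices n`. -/
def IsNetPath (n : ℕ) : (u e : ℤ × ℤ) → List NetStep → Prop
  | u, e, [] => u ∈ networkVertices n ∧ u = e
  | u, e, s :: p => u ∈ networkVertices n ∧ IsNetPath n (u + s.disp) e p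

/-- The product of the weights of the edges traversed by a path that starts at `u`. -/
def netPathWeight {K : Type*} [Field K] (n : ℕ) (lam mu : ℤ → K) (α : ℤ × ℤ → K) :
    (u : ℤ × ℤ) → List NetStep → K
  | _, [] => 1
  | u, s :: p => s.weight n lam mu α u * netPathWeight n lam mu α (u + s.disp) p

/-- The partition function for paths from `u` to `e`: the sum of their weights. -/
noncomputable def netPartition {K : Type*} [Field K] (n : ℕ) (lam mu : ℤ → K)
    (α : ℤ × ℤ → K) (u e : ℤ × ℤ) : K :=
  ∑ᶠ p ∈ {p : List NetStep | IsNetPath n u e p}, netPathWeight n lam mu α u p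

/-!
Every edge of the network increases `x`, so `T` raises the filtration of `H` by `x`, the series
`∑ T ^ k` converges to `(I - T)⁻¹`, and the matrix elements of `(I - T)⁻¹` are sums over paths.
Bidiagonal row and column operations, which express the decomposition of a path according to its
first or its last step, identify the minors of the matrix of path sums that enter the
Desnanot–Jacobi identity with path determinants of smaller blocks. The identity thereby becomes the
recursion that defines the Lambda-determinant, as long as no `λ_a` vanishes and nothing is divided
by zero. For the matrix of indeterminates this holds, because at the point with all coordinates `1`
the path determinants are positive. The path determinant divides by the values of `α` only, so the
identity specializes to every matrix with non-zero entries.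
-/

/-! ### Determinant identities -/

section Determinants

variable {R : Type*} [CommRing R]

theorem det_mul_det_toBlocks₁₁_adjugate {l m : Type*} [Fintype l] [DecidableEq l] [Fintype m]
    [DecidableEq m] (A : Matrix (l ⊕ m) (l ⊕ m) R) :
    A.det * A.adjugate.toBlocks₁₁.det = A.det ^ Fintype.card l * A.toBlocks₂₂.det := by
  have hadj := A.mul_adjugate
  rw [← A.fromBlocks_toBlocks, ← Matrix.fromBlocks_toBlocks (Matrix.adjugate _),
    Matrix.fromBlocks_multiply, ← Matrix.fromBlocks_one, Matrix.fromBlocks_smul,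
    Matrix.fromBlocks_inj] at hadj
  simp only [Matrix.fromBlocks_toBlocks] at hadj
  have hmul : A * Matrix.fromBlocks A.adjugate.toBlocks₁₁ 0 A.adjugate.toBlocks₂₁ 1 =
      Matrix.fromBlocks (A.det • 1) A.toBlocks₁₂ 0 A.toBlocks₂₂ := by
    conv_lhs => rw [← A.fromBlocks_toBlocks, Matrix.fromBlocks_toBlocks A]
    nth_rw 1 [← A.fromBlocks_toBlocks]
    rw [Matrix.fromBlocks_multiply, hadj.1, hadj.2.2.1]
    simp
  simpa using congrArg Matrix.det hmul

theorem det_toBlocks₁₁_adjugate {l m : Type*} [Fintype l] [DecidableEq l] [Nonempty l] [Fintype m]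
    [DecidableEq m] (A : Matrix (l ⊕ m) (l ⊕ m) R) :
    A.adjugate.toBlocks₁₁.det = A.det ^ (Fintype.card l - 1) * A.toBlocks₂₂.det := by
  -- For the generic matrix the determinant can be cancelled.
  let X := Matrix.mvPolynomialX (l ⊕ m) (l ⊕ m) ℤ
  have hX : X.adjugate.toBlocks₁₁.det = X.det ^ (Fintype.card l - 1) * X.toBlocks₂₂.det := by
    apply mul_left_cancel₀ (Matrix.det_mvPolynomialX_ne_zero (l ⊕ m) ℤ)
    rw [det_mul_det_toBlocks₁₁_adjugate, ← mul_assoc, mul_pow_sub_one Fintype.card_ne_zero]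
  let φ := MvPolynomial.aeval (R := ℤ) fun p : (l ⊕ m) × (l ⊕ m) => A p.1 p.2
  have hA : φ.mapMatrix X = A := Matrix.mvPolynomialX_mapMatrix_aeval ℤ A
  have hblock : φ.mapMatrix X.toBlocks₂₂ = A.toBlocks₂₂ := congrArg Matrix.toBlocks₂₂ hA
  have hadj : φ.mapMatrix X.adjugate.toBlocks₁₁ = A.adjugate.toBlocks₁₁ :=
    congrArg Matrix.toBlocks₁₁ ((φ.map_adjugate X).trans (congrArg _ hA))
  rw [← hadj, ← hblock, ← AlgHom.map_det, ← AlgHom.map_det, hX, map_mul, map_pow,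
    AlgHom.map_det, hA]

theorem desnanot_jacobi (k : ℕ) (A : Matrix (Fin (k + 2)) (Fin (k + 2)) R) :
    A.det * (A.submatrix (fun i : Fin k => i.castSucc.succ) fun i => i.castSucc.succ).det =
      (A.submatrix Fin.succ Fin.succ).det * (A.submatrix Fin.castSucc Fin.castSucc).det -
      (A.submatrix Fin.succ Fin.castSucc).det * (A.submatrix Fin.castSucc Fin.succ).det := by
  let f : Fin 2 ⊕ Fin k → Fin (k + 2) := Sum.elim ![0, Fin.last (k + 1)] fun i => i.castSucc.succ
  have hf : Function.Bijective f := by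
    rw [Fintype.bijective_iff_surjective_and_card]
    refine ⟨fun i => ?_, by simp [add_comm]⟩
    induction i using Fin.cases with
    | zero => exact ⟨.inl 0, rfl⟩
    | succ i =>
      induction i using Fin.lastCases with
      | last => exact ⟨.inl 1, rfl⟩
      | cast i => exact ⟨.inr i, rfl⟩
  let e := Equiv.ofBijective f hf
  have hminor : A.adjugate 0 0 * A.adjugate (Fin.last _) (Fin.last _) -
      A.adjugate 0 (Fin.last _) * A.adjugate (Fin.last _) 0 =
      A.det * (A.submatrix (fun i : Fin k => i.castSucc.succ) fun i => i.castSucc.succ).det := by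
    have h := det_toBlocks₁₁_adjugate (A.submatrix e e)
    rw [Matrix.adjugate_submatrix_equiv_self, Matrix.det_submatrix_equiv_self,
      Matrix.det_fin_two, Fintype.card_fin, pow_one] at h
    exact h
  have hsign : ((-1 : R) ^ (k + 1)) * (-1) ^ (k + 1) = 1 := by simp [← mul_pow]
  rw [← hminor]
  simp only [Matrix.adjugate_fin_succ_eq_det_submatrix, Fin.succAbove_zero, Fin.succAbove_last,
    Fin.val_zero, Fin.val_last, add_zero, zero_add, pow_zero, one_mul, pow_add _ (k + 1), hsign]
  linear_combination (-(A.submatrix Fin.succ Fin.castSucc).det *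
    (A.submatrix Fin.castSucc Fin.succ).det) * hsign

/-- The lower bidiagonal matrix with diagonal `d 0, d 1, …` and subdiagonal `s 0, s 1, …`. -/
def lowerBidiagonal (k : ℕ) (d s : ℕ → R) : Matrix (Fin k) (Fin k) R :=
  .of fun i j => (if i = j then d i else 0) + if (i : ℕ) = j + 1 then s j else 0

theorem det_lowerBidiagonal (k : ℕ) (d s : ℕ → R) :
    (lowerBidiagonal k d s).det = ∏ i : Fin k, d i := by
  rw [Matrix.det_of_isLowerTriangular]
  · simp [lowerBidiagonal]
  · intro i j hij
    have hij : i < j := hij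
    simp [lowerBidiagonal, hij.ne, show (i : ℕ) ≠ j + 1 by omega]

theorem lowerBidiagonal_mul_zero {k : ℕ} {m : Type*} (d s : ℕ → R)
    (M : Matrix (Fin (k + 1)) m R) (c : m) :
    (lowerBidiagonal (k + 1) d s * M) 0 c = d 0 * M 0 c := by
  simp [Matrix.mul_apply, lowerBidiagonal]

theorem lowerBidiagonal_mul_succ {k : ℕ} {m : Type*} (d s : ℕ → R)
    (M : Matrix (Fin (k + 1)) m R) (i : Fin k) (c : m) :
    (lowerBidiagonal (k + 1) d s * M) i.succ c =
      d (i + 1) * M i.succ c + s i * M i.castSucc c := by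
  have hsub : ∀ j : Fin (k + 1), (i : ℕ) + 1 = j + 1 ↔ i.castSucc = j := fun j => by
    simp [Fin.ext_iff]
  simp only [Matrix.mul_apply, lowerBidiagonal, Matrix.of_apply, add_mul,
    Finset.sum_add_distrib, Fin.val_succ, hsub, ite_mul, zero_mul, Finset.sum_ite_eq,
    Finset.mem_univ, if_true, Fin.val_castSucc]

theorem det_of_bidiagonal_rows {k : ℕ} {M M' : ℕ → Fin k → R} (d p q : ℕ → R)
    (hzero : ∀ c, M 0 c = d 0 * M' 0 c)
    (hsucc : ∀ i c, M (i + 1) c = p i * M i c + d (i + 1) * M' (i + 1) c + q i * M' i c) :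
    (Matrix.of fun i j : Fin k => M i j).det =
      (∏ i : Fin k, d i) * (Matrix.of fun i j : Fin k => M' i j).det := by
  have hmul : lowerBidiagonal k 1 (-p) * (Matrix.of fun i j : Fin k => M i j) =
      lowerBidiagonal k d q * Matrix.of fun i j : Fin k => M' i j := by
    cases k with
    | zero => exact Subsingleton.elim _ _
    | succ k =>
      ext i c
      induction i using Fin.cases with
      | zero => simp [lowerBidiagonal_mul_zero, hzero]
      | succ i =>
        simp only [lowerBidiagonal_mul_succ, Matrix.of_apply, Fin.val_succ, hsucc, Pi.one_apply,
          Pi.neg_apply, Fin.val_castSucc]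
        ring
  simpa [det_lowerBidiagonal] using congrArg Matrix.det hmul

end Determinants

/-! ### The resolvent of the transfer operator -/

section Filtration

variable {K : Type*} [Field K]

/-- The vectors supported in the half-plane `x ≥ N`. These subspaces form a separated and complete
decreasing filtration of `LatticeSpace K`, along which geometric series of operators converge. -/
def supportedFrom (K : Type*) [Field K] (N : ℤ) : Submodule K (LatticeSpace K) where
  carrier := {f | ∀ v : ℤ × ℤ, v.1 < N → f.1 v = 0}
  add_mem' hf hg v hv := by simp [hf v hv, hg v hv]
  zero_mem' _ _ := rfl
  smul_mem' c f hf v hv := by simp [hf v hv]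

theorem eq_zero_of_forall_mem_supportedFrom {f : LatticeSpace K} {N : ℤ}
    (hf : ∀ k : ℕ, f ∈ supportedFrom K (N + k)) : f = 0 := by
  ext v
  exact hf (v.1 - N + 1).toNat v (by omega)

theorem exists_forall_sub_sum_mem_supportedFrom {g : ℕ → LatticeSpace K} {N : ℤ}
    (hg : ∀ k : ℕ, g k ∈ supportedFrom K (N + k)) :
    ∃ F : LatticeSpace K, ∀ M : ℕ,
      F - ∑ k ∈ Finset.range M, g k ∈ supportedFrom K (N + M) := by
  refine ⟨⟨fun v => ∑ k ∈ Finset.range (v.1 - N + 1).toNat, (g k).1 v, N, fun v hv => ?_⟩,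
    fun M v hv => ?_⟩
  · simp [Int.toNat_of_nonpos (show v.1 - N + 1 ≤ 0 by omega)]
  · simp only [AddSubgroupClass.coe_sub, Submodule.coe_sum, Pi.sub_apply, Finset.sum_apply]
    rw [sub_eq_zero]
    refine Finset.sum_subset (Finset.range_subset_range.2 (by omega)) fun k _ hk => hg k v ?_
    rw [Finset.mem_range] at hk
    omega

variable {T : Module.End K (LatticeSpace K)}

theorem pow_mem_supportedFrom (hT : ∀ N, ∀ f ∈ supportedFrom K N, T f ∈ supportedFrom K (N + 1))
    {N : ℤ} {f : LatticeSpace K} (hf : f ∈ supportedFrom K N) (k : ℕ) :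
    (T ^ k) f ∈ supportedFrom K (N + k) := by
  induction k with
  | zero => simpa using hf
  | succ k ih =>
    rw [pow_succ', Nat.cast_succ, ← add_assoc]
    exact hT _ _ ih

theorem isUnit_one_sub_of_raises_supportedFrom
    (hT : ∀ N, ∀ f ∈ supportedFrom K N, T f ∈ supportedFrom K (N + 1)) : IsUnit (1 - T) := by
  rw [Module.End.isUnit_iff]
  constructor
  · rw [← LinearMap.ker_eq_bot, LinearMap.ker_eq_bot']
    intro f hf
    have hfix : T f = f := (sub_eq_zero.mp hf).symm
    obtain ⟨N, hN⟩ := f.2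
    refine eq_zero_of_forall_mem_supportedFrom (N := N) fun k => ?_
    have hpow : (T ^ k) f = f := by
      rw [Module.End.coe_pow]
      exact Function.iterate_fixed hfix k
    exact hpow ▸ pow_mem_supportedFrom hT hN k
  · intro f
    obtain ⟨N, hN⟩ := f.2
    obtain ⟨F, hF⟩ := exists_forall_sub_sum_mem_supportedFrom (pow_mem_supportedFrom hT hN)
    refine ⟨F, sub_eq_zero.mp (eq_zero_of_forall_mem_supportedFrom (N := N) fun M => ?_)⟩
    have hgeom : (1 - T) (∑ k ∈ Finset.range M, (T ^ k) f) = f - (T ^ M) f := by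
      simpa [LinearMap.sum_apply] using LinearMap.congr_fun (mul_neg_geom_sum T M) f
    have hsplit : (1 - T) F - f =
        (1 - T) (F - ∑ k ∈ Finset.range M, (T ^ k) f) - (T ^ M) f := by
      rw [map_sub, hgeom]
      abel
    rw [hsplit]
    refine sub_mem (sub_mem (hF M) fun v hv => ?_) (pow_mem_supportedFrom hT hN M)
    exact hT _ _ (hF M) v (by omega)

end Filtration

section Resolvent

instance : Fintype NetStep where
  elems := ⟨([.up, .flat, .down] : List NetStep), by simp⟩
  complete s := by cases s <;> simp

theorem NetStep.sum_univ {M : Type*} [AddCommMonoid M] (f : NetStep → M) :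
    ∑ s, f s = f .up + f .flat + f .down := by
  change f .up + (f .flat + (f .down + 0)) = _
  rw [add_zero, add_assoc]

variable {K : Type*} [Field K] (n : ℕ) (lam mu : ℤ → K) (α : ℤ × ℤ → K)

theorem transferOp_apply (f : LatticeSpace K) (v : ℤ × ℤ) :
    (transferOp n lam mu α f).1 v = ∑ s : NetStep,
      s.weight n lam mu α (v - s.disp) * f.1 (v - s.disp) := by
  have hflat : v - (1, 1) - (1, -1) = v - (2, 0) := by ext <;> simp; omega
  have hdown : v - (2, 0) + (1, -1) = v - (1, 1) := by ext <;> simp <;> omega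
  have hexpand : (transferOp n lam mu α f).1 v =
      lam ((v - (1, 1)).2 + 1 - n) * f.1 (v - (1, 1)) +
      mu (v - (1, 1)).1 * ((α (v - (1, 1)))⁻¹ *
        (α (v - (1, 1) - (1, -1)) * f.1 (v - (1, 1) - (1, -1)))) +
      (α v)⁻¹ * (α (v - (1, -1)) * f.1 (v - (1, -1))) := rfl
  have hmu : (v - (2, 0)).1 + 1 = (v - (1, 1)).1 := by simp; omega
  simp only [hexpand, NetStep.sum_univ, NetStep.weight, NetStep.disp, hflat, hdown, hmu,
    sub_add_cancel]
  ring

theorem ket_apply (u v : ℤ × ℤ) : (ket K u).1 v = if u = v then 1 else 0 := by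
  simp [ket, Pi.single_apply, eq_comm]

theorem transferOp_ket (u : ℤ × ℤ) :
    transferOp n lam mu α (ket K u) =
      ∑ s : NetStep, s.weight n lam mu α u • ket K (u + s.disp) := by
  ext v
  simp only [transferOp_apply, Submodule.coe_sum, Submodule.coe_smul, Finset.sum_apply,
    Pi.smul_apply, ket_apply, smul_eq_mul, eq_sub_iff_add_eq]
  refine Finset.sum_congr rfl fun s _ => ?_
  split_ifs with h
  · rw [← h, add_sub_cancel_right]
  · rw [mul_zero, mul_zero]

theorem NetStep.one_le_disp_fst (s : NetStep) : 1 ≤ s.disp.1 := by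
  cases s <;> simp [NetStep.disp]

theorem isUnit_one_sub_transferOp : IsUnit (1 - transferOp n lam mu α) := by
  refine isUnit_one_sub_of_raises_supportedFrom fun N f hf v hv => ?_
  rw [transferOp_apply]
  refine Finset.sum_eq_zero fun s _ => ?_
  rw [hf _ (by have := s.one_le_disp_fst; rw [Prod.fst_sub]; omega), mul_zero]

/-- The matrix elements of the resolvent `(I - T)⁻¹`: `green n lam mu α u v` is the total weight of
the lattice paths from `u` to `v`. -/
noncomputable def green (u v : ℤ × ℤ) : K :=
  bra K v (Ring.inverse (1 - transferOp n lam mu α) (ket K u))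

theorem green_eq_first_step (u v : ℤ × ℤ) :
    green n lam mu α u v = (if u = v then 1 else 0) +
      ∑ s : NetStep, s.weight n lam mu α u * green n lam mu α (u + s.disp) v := by
  have h := congrArg (fun g : Module.End K (LatticeSpace K) => bra K v (g (ket K u)))
    (Ring.inverse_mul_cancel _ (isUnit_one_sub_transferOp n lam mu α))
  simp only [Module.End.mul_apply, LinearMap.sub_apply, Module.End.one_apply, transferOp_ket,
    map_sub, map_sum, map_smul, smul_eq_mul, sub_eq_iff_eq_add] at h
  exact h.trans (congrArg (· + _) (ket_apply u v))

theorem green_eq_last_step (u v : ℤ × ℤ) :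
    green n lam mu α u v = (if u = v then 1 else 0) +
      ∑ s : NetStep, s.weight n lam mu α (v - s.disp) * green n lam mu α u (v - s.disp) := by
  have h := congrArg (fun g : Module.End K (LatticeSpace K) => (g (ket K u)).1 v)
    (Ring.mul_inverse_cancel _ (isUnit_one_sub_transferOp n lam mu α))
  simp only [Module.End.mul_apply, LinearMap.sub_apply, Module.End.one_apply,
    AddSubgroupClass.coe_sub, Pi.sub_apply, transferOp_apply, ket_apply, sub_eq_iff_eq_add] at h
  exact h

theorem NetStep.abs_disp_snd_le (s : NetStep) : |s.disp.2| ≤ s.disp.1 := by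
  cases s <;> simp [NetStep.disp]

theorem green_eq_zero {u v : ℤ × ℤ} (h : v.1 - u.1 < |v.2 - u.2|) :
    green n lam mu α u v = 0 := by
  obtain ⟨N, hN⟩ := (Ring.inverse (1 - transferOp n lam mu α) (ket K u)).2
  obtain ⟨m, hm⟩ : ∃ m : ℕ, v.1 < N + m := ⟨(v.1 - N + 1).toNat, by omega⟩
  induction m generalizing v with
  | zero => exact hN v (by simpa using hm)
  | succ m ih =>
    have huv : u ≠ v := by rintro rfl; simp at h
    rw [green_eq_last_step, if_neg huv, zero_add]
    refine Finset.sum_eq_zero fun s _ => ?_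
    rw [ih, mul_zero]
    · have htri := abs_sub_abs_le_abs_sub (v.2 - u.2) s.disp.2
      have := s.abs_disp_snd_le
      rw [Prod.fst_sub, Prod.snd_sub, sub_right_comm _ _ u.2]
      omega
    · have := s.one_le_disp_fst
      rw [Prod.fst_sub]
      omega

theorem green_self (u : ℤ × ℤ) : green n lam mu α u u = 1 := by
  rw [green_eq_last_step, if_pos rfl, Finset.sum_eq_zero, add_zero]
  intro s _
  rw [green_eq_zero, mul_zero]
  have := s.one_le_disp_fst
  have := abs_nonneg ((u - s.disp).2 - u.2)
  rw [Prod.fst_sub]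
  omega

end Resolvent

/-! ### The octahedron relation -/

section Octahedron

/-- The lattice point that carries the entry in column `c` and in row `a`, both counted from `0`,
the rows from the bottom up. In these coordinates the three kinds of edges are
`(a, c) → (a, c + 1)`, `(a, c) → (a - 1, c + 1)` and `(a, c) → (a - 1, c)`. -/
def latticePoint (a c : ℤ) : ℤ × ℤ := (c - a, c + a)

theorem latticePoint_add_up (a c : ℤ) : latticePoint a c + (1, 1) = latticePoint a (c + 1) := by
  ext <;> simp only [latticePoint, Prod.fst_add, Prod.snd_add] <;> ring

theorem latticePoint_add_flat (a c : ℤ) :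
    latticePoint (a + 1) c + (2, 0) = latticePoint a (c + 1) := by
  ext <;> simp only [latticePoint, Prod.fst_add, Prod.snd_add] <;> ring

theorem latticePoint_add_down (a c : ℤ) : latticePoint (a + 1) c + (1, -1) = latticePoint a c := by
  ext <;> simp only [latticePoint, Prod.fst_add, Prod.snd_add] <;> ring

section Block

variable {X : Type*} (α : ℤ × ℤ → X) (k : ℕ) (a j : ℤ)

/-- The `k × k` block of labels whose bottom left corner is in row `a` and column `j`. -/
def labelBlock : Matrix (Fin k) (Fin k) X :=
  .of fun i c => α (latticePoint (a + i.rev) (j + c))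

theorem labelBlock_submatrix_castSucc_castSucc :
    (labelBlock α (k + 1) a j).submatrix Fin.castSucc Fin.castSucc = labelBlock α k (a + 1) j := by
  ext i c
  refine congrArg α ?_
  simp only [latticePoint, Fin.val_rev, Fin.val_castSucc, Prod.mk.injEq]
  omega

theorem labelBlock_submatrix_succ_succ :
    (labelBlock α (k + 1) a j).submatrix Fin.succ Fin.succ = labelBlock α k a (j + 1) := by
  ext i c
  refine congrArg α ?_
  simp only [latticePoint, Fin.val_rev, Fin.val_succ, Prod.mk.injEq]
  omega

theorem labelBlock_submatrix_succ_castSucc :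
    (labelBlock α (k + 1) a j).submatrix Fin.succ Fin.castSucc = labelBlock α k a j := by
  ext i c
  refine congrArg α ?_
  simp only [latticePoint, Fin.val_rev, Fin.val_castSucc, Fin.val_succ, Prod.mk.injEq]
  omega

theorem labelBlock_submatrix_castSucc_succ :
    (labelBlock α (k + 1) a j).submatrix Fin.castSucc Fin.succ =
      labelBlock α k (a + 1) (j + 1) := by
  ext i c
  refine congrArg α ?_
  simp only [latticePoint, Fin.val_rev, Fin.val_castSucc, Fin.val_succ, Prod.mk.injEq]
  omega

theorem labelBlock_submatrix_interior :
    (labelBlock α (k + 2) a j).submatrix (fun i => i.castSucc.succ) (fun i => i.castSucc.succ) =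
      labelBlock α k (a + 1) (j + 1) := by
  rw [← labelBlock_submatrix_castSucc_castSucc, ← labelBlock_submatrix_succ_succ]
  rfl

end Block

variable {K : Type*} [Field K] (n : ℕ) (lam mu : ℤ → K) (α : ℤ × ℤ → K)

/-- The matrix elements of `α̂ (I - T)⁻¹`. -/
noncomputable def weightedGreen (u v : ℤ × ℤ) : K := α v * green n lam mu α u v

theorem weightedGreen_eq_zero {s j r c : ℤ} (h : c < j ∨ s < r) :
    weightedGreen n lam mu α (latticePoint s j) (latticePoint r c) = 0 := by
  rw [weightedGreen, green_eq_zero, mul_zero]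
  simp only [latticePoint, lt_abs]
  omega

theorem weightedGreen_first_step {s j : ℤ} {v : ℤ × ℤ} (h : latticePoint (s + 1) j ≠ v) :
    weightedGreen n lam mu α (latticePoint (s + 1) j) v =
      lam (j + s + 2 - n) * weightedGreen n lam mu α (latticePoint (s + 1) (j + 1)) v +
      mu (j - s) * (α (latticePoint (s + 1) j) / α (latticePoint s j)) *
        weightedGreen n lam mu α (latticePoint s (j + 1)) v +
      α (latticePoint (s + 1) j) / α (latticePoint s j) *
        weightedGreen n lam mu α (latticePoint s j) v := by
  have hlam : (latticePoint (s + 1) j).2 + 1 - n = j + s + 2 - n := by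
    simp only [latticePoint]; ring
  have hmu : (latticePoint (s + 1) j).1 + 1 = j - s := by simp only [latticePoint]; ring
  simp only [weightedGreen]
  rw [green_eq_first_step, if_neg h, NetStep.sum_univ]
  simp only [NetStep.weight, NetStep.disp, latticePoint_add_up, latticePoint_add_flat,
    latticePoint_add_down, hlam, hmu]
  ring

variable {α}

theorem weightedGreen_last_step (hα : ∀ v, α v ≠ 0) {u : ℤ × ℤ} {r c : ℤ}
    (h : u ≠ latticePoint r (c + 1)) :
    weightedGreen n lam mu α u (latticePoint r (c + 1)) =
      lam (c + r + 1 - n) * (α (latticePoint r (c + 1)) / α (latticePoint r c)) *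
        weightedGreen n lam mu α u (latticePoint r c) +
      mu (c - r) * (α (latticePoint r (c + 1)) / α (latticePoint r c)) *
        weightedGreen n lam mu α u (latticePoint (r + 1) c) +
      weightedGreen n lam mu α u (latticePoint (r + 1) (c + 1)) := by
  have hup : latticePoint r (c + 1) - (1, 1) = latticePoint r c :=
    sub_eq_of_eq_add (latticePoint_add_up r c).symm
  have hflat : latticePoint r (c + 1) - (2, 0) = latticePoint (r + 1) c :=
    sub_eq_of_eq_add (latticePoint_add_flat r c).symm
  have hdown : latticePoint r (c + 1) - (1, -1) = latticePoint (r + 1) (c + 1) :=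
    sub_eq_of_eq_add (latticePoint_add_down r (c + 1)).symm
  have hlam : (latticePoint r c).2 + 1 - n = c + r + 1 - n := by simp only [latticePoint]
  have hmu : (latticePoint (r + 1) c).1 + 1 = c - r := by simp only [latticePoint]; ring
  simp only [weightedGreen]
  rw [green_eq_last_step, if_neg h, NetStep.sum_univ]
  simp only [NetStep.weight, NetStep.disp, hup, hflat, hdown, latticePoint_add_down, hlam, hmu]
  have := hα (latticePoint r (c + 1))
  have := hα (latticePoint r c)
  field_simp
  ring

variable (α)

/-- The path determinant attached to the `k × k` block of labels whose bottom left corner is in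
row `a` and column `j`. The paths start in column `j` of the block and end in its bottom row. -/
noncomputable def blockDet (k : ℕ) (a j : ℤ) : K :=
  (Matrix.of fun i c : Fin k =>
    weightedGreen n lam mu α (latticePoint (a + i) j) (latticePoint a (j + c))).det

/-- The matrix that column operations make out of the matrix of `blockDet`: its rows `1, 2, …` form
the matrix of the block one row higher, so that the minors of both fit together. -/
noncomputable def condensedRow (a j : ℤ) : ℕ → ℕ → K
  | 0, c => (-1) ^ c * α (latticePoint a (j + c)) * ∏ t ∈ Finset.range c, mu (j - a + t)
  | i + 1, c =>
    weightedGreen n lam mu α (latticePoint (a + 1 + i) j) (latticePoint (a + 1) (j + c))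

variable {α}

theorem weightedGreen_eq_condensedRow_zero (hα : ∀ v, α v ≠ 0) (a j : ℤ) (i : ℕ) :
    weightedGreen n lam mu α (latticePoint (a + i) j) (latticePoint a j) =
      condensedRow n lam mu α a j i 0 := by
  cases i with
  | zero => simp [condensedRow, weightedGreen, green_self]
  | succ i =>
    have hne : latticePoint (a + (i + 1 : ℕ)) j ≠ latticePoint a (j - 1 + 1) := by
      simp only [latticePoint, ne_eq, Prod.mk.injEq]; omega
    have h := weightedGreen_last_step n lam mu hα hne
    rw [weightedGreen_eq_zero n lam mu α (Or.inl (sub_one_lt j)),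
      weightedGreen_eq_zero n lam mu α (Or.inl (sub_one_lt j)), sub_add_cancel] at h
    simpa [condensedRow, add_assoc, add_comm (1 : ℤ)] using h

theorem weightedGreen_eq_condensedRow_succ (hα : ∀ v, α v ≠ 0) (a j : ℤ) (i c : ℕ) :
    weightedGreen n lam mu α (latticePoint (a + i) j) (latticePoint a (j + c + 1)) =
      lam (j + c + a + 1 - n) * (α (latticePoint a (j + c + 1)) / α (latticePoint a (j + c))) *
        weightedGreen n lam mu α (latticePoint (a + i) j) (latticePoint a (j + c)) +
      condensedRow n lam mu α a j i (c + 1) +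
      mu (j + c - a) * (α (latticePoint a (j + c + 1)) / α (latticePoint a (j + c))) *
        condensedRow n lam mu α a j i c := by
  have hne : latticePoint (a + i) j ≠ latticePoint a (j + c + 1) := by
    simp only [latticePoint, ne_eq, Prod.mk.injEq]; omega
  rw [weightedGreen_last_step n lam mu hα hne]
  cases i with
  | zero =>
    have hcancel : condensedRow n lam mu α a j 0 (c + 1) +
        mu (j + c - a) * (α (latticePoint a (j + c + 1)) / α (latticePoint a (j + c))) *
          condensedRow n lam mu α a j 0 c = 0 := by
      have := hα (latticePoint a (j + c))
      simp only [condensedRow, Finset.prod_range_succ, Nat.cast_succ, ← add_assoc, pow_succ,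
        sub_add_eq_add_sub]
      field_simp
      ring
    have hunreachable : ∀ c' : ℤ, weightedGreen n lam mu α (latticePoint (a + (0 : ℕ)) j)
        (latticePoint (a + 1) c') = 0 := fun c' =>
      weightedGreen_eq_zero n lam mu α (Or.inr (by simp))
    rw [hunreachable, hunreachable]
    linear_combination -hcancel
  | succ i =>
    simp only [condensedRow, Nat.cast_succ, ← add_assoc, add_right_comm a 1]
    ring

theorem blockDet_eq_det_condensedRow (hα : ∀ v, α v ≠ 0) (k : ℕ) (a j : ℤ) :
    blockDet n lam mu α k a j =
      (Matrix.of fun i c : Fin k => condensedRow n lam mu α a j i c).det := by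
  rw [← Matrix.det_transpose (Matrix.of fun i c : Fin k => condensedRow n lam mu α a j i c),
    blockDet, ← Matrix.det_transpose]
  have h := det_of_bidiagonal_rows (k := k)
    (M := fun c i => weightedGreen n lam mu α (latticePoint (a + i) j) (latticePoint a (j + c)))
    (M' := fun c i => condensedRow n lam mu α a j i c) 1
    (fun c => lam (j + c + a + 1 - n) *
      (α (latticePoint a (j + c + 1)) / α (latticePoint a (j + c))))
    (fun c => mu (j + c - a) * (α (latticePoint a (j + c + 1)) / α (latticePoint a (j + c))))
    (fun i => by simpa using weightedGreen_eq_condensedRow_zero n lam mu hα a j i)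
    (fun c i => by
      simpa [add_assoc] using weightedGreen_eq_condensedRow_succ n lam mu hα a j i c)
  simp only [Pi.one_apply, Finset.prod_const_one, one_mul] at h
  exact h

theorem condensedRow_zero_succ (a j : ℤ) (c : ℕ) :
    condensedRow n lam mu α a j 0 (c + 1) =
      -mu (j - a) * condensedRow n lam mu α a (j + 1) 0 c := by
  simp only [condensedRow, Finset.prod_range_succ', Nat.cast_zero, add_zero, Nat.cast_succ,
    add_right_comm j 1, ← add_assoc, pow_succ, add_sub_right_comm j 1 a]
  simp only [add_right_comm (j - a) 1]
  ring

theorem condensedRow_one_succ (a j : ℤ) (c : ℕ) :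
    condensedRow n lam mu α a j 1 (c + 1) =
      lam (j + a + 2 - n) * condensedRow n lam mu α a (j + 1) 1 c := by
  have hne : latticePoint (a + 1) j ≠ latticePoint (a + 1) (j + 1 + c) := by
    simp only [latticePoint, ne_eq, Prod.mk.injEq]; omega
  have h := weightedGreen_first_step n lam mu α hne
  rw [weightedGreen_eq_zero n lam mu α (Or.inr (lt_add_one a)),
    weightedGreen_eq_zero n lam mu α (Or.inr (lt_add_one a))] at h
  simpa [condensedRow, add_assoc, add_comm (1 : ℤ)] using h

theorem condensedRow_add_two_succ (a j : ℤ) (i c : ℕ) :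
    condensedRow n lam mu α a j (i + 2) (c + 1) =
      α (latticePoint (a + 1 + i + 1) j) / α (latticePoint (a + 1 + i) j) *
        condensedRow n lam mu α a j (i + 1) (c + 1) +
      lam (j + a + (i + 1 : ℕ) + 2 - n) * condensedRow n lam mu α a (j + 1) (i + 2) c +
      mu (j - (a + 1 + i)) *
        (α (latticePoint (a + 1 + i + 1) j) / α (latticePoint (a + 1 + i) j)) *
        condensedRow n lam mu α a (j + 1) (i + 1) c := by
  have hne : latticePoint (a + 1 + i + 1) j ≠ latticePoint (a + 1) (j + 1 + c) := by
    simp only [latticePoint, ne_eq, Prod.mk.injEq]; omega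
  have h := weightedGreen_first_step n lam mu α hne
  rw [show j + (a + 1 + i) + 2 - n = j + a + (i + 1 : ℕ) + 2 - n by push_cast; ring] at h
  simp only [condensedRow, Nat.cast_succ, ← add_assoc, add_right_comm j _ (1 : ℤ)] at h ⊢
  rw [h]
  ring

theorem det_condensedRow_succ_succ (k : ℕ) (a j : ℤ) :
    (Matrix.of fun i c : Fin k => condensedRow n lam mu α a j (i + 1) (c + 1)).det =
      (∏ i : Fin k, lam (j + a + i + 2 - n)) * blockDet n lam mu α k (a + 1) (j + 1) :=
  det_of_bidiagonal_rows (M := fun i c => condensedRow n lam mu α a j (i + 1) (c + 1))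
    (M' := fun i c => condensedRow n lam mu α a (j + 1) (i + 1) c)
    (fun i => lam (j + a + i + 2 - n)) _ _
    (fun c => by simpa using condensedRow_one_succ n lam mu a j c)
    fun i c => condensedRow_add_two_succ n lam mu a j i c

theorem det_condensedRow_succ (hα : ∀ v, α v ≠ 0) (k : ℕ) (a j : ℤ) :
    (Matrix.of fun i c : Fin (k + 1) => condensedRow n lam mu α a j i (c + 1)).det =
      -mu (j - a) * (∏ i : Fin k, lam (j + a + i + 2 - n)) *
        blockDet n lam mu α (k + 1) a (j + 1) := by
  let ρ : ℕ → K := fun i => α (latticePoint (a + 1 + i + 1) j) / α (latticePoint (a + 1 + i) j)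
  have h := det_of_bidiagonal_rows (k := k + 1)
    (M := fun i c => condensedRow n lam mu α a j i (c + 1))
    (M' := fun i c => condensedRow n lam mu α a (j + 1) i c)
    (fun | 0 => -mu (j - a) | i + 1 => lam (j + a + i + 2 - n))
    (fun | 0 => 0 | i + 1 => ρ i)
    (fun | 0 => 0 | i + 1 => mu (j - (a + 1 + i)) * ρ i)
    (fun c => condensedRow_zero_succ n lam mu a j c) (fun i c => by
      cases i with
      | zero => simpa using condensedRow_one_succ n lam mu a j c
      | succ i => exact condensedRow_add_two_succ n lam mu a j i c)
  rwa [Fin.prod_univ_succ, ← blockDet_eq_det_condensedRow n lam mu hα] at h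

theorem blockDet_octahedron (hα : ∀ v, α v ≠ 0) (hlam : ∀ d, lam d ≠ 0) (k : ℕ) (a j : ℤ) :
    blockDet n lam mu α (k + 2) a j * blockDet n lam mu α k (a + 1) (j + 1) =
      mu (j - a) * blockDet n lam mu α (k + 1) a (j + 1) * blockDet n lam mu α (k + 1) (a + 1) j +
      lam (j + a + k + 2 - n) * blockDet n lam mu α (k + 1) a j *
        blockDet n lam mu α (k + 1) (a + 1) (j + 1) := by
  let C : Matrix (Fin (k + 2)) (Fin (k + 2)) K := .of fun i c => condensedRow n lam mu α a j i c
  have hcorner : (C.submatrix Fin.castSucc Fin.castSucc).det = blockDet n lam mu α (k + 1) a j :=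
    (blockDet_eq_det_condensedRow n lam mu hα (k + 1) a j).symm
  have hraise : (C.submatrix Fin.succ Fin.castSucc).det = blockDet n lam mu α (k + 1) (a + 1) j :=
    rfl
  have hright : (C.submatrix Fin.castSucc Fin.succ).det = _ :=
    det_condensedRow_succ n lam mu hα k a j
  have hdiag : (C.submatrix Fin.succ Fin.succ).det = _ :=
    det_condensedRow_succ_succ n lam mu (k + 1) a j
  have hinner : (C.submatrix (fun i : Fin k => i.castSucc.succ) fun i => i.castSucc.succ).det = _ :=
    det_condensedRow_succ_succ n lam mu k a j
  have hprod : ∏ i : Fin k, lam (j + a + i + 2 - n) ≠ 0 :=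
    Finset.prod_ne_zero_iff.2 fun i _ => hlam _
  have h := desnanot_jacobi k C
  rw [hcorner, hraise, hright, hdiag, hinner, Fin.prod_univ_castSucc,
    ← blockDet_eq_det_condensedRow n lam mu hα] at h
  simp only [Fin.val_castSucc, Fin.val_last] at h
  apply mul_left_cancel₀ hprod
  linear_combination h

theorem blockDet_zero (a j : ℤ) : blockDet n lam mu α 0 a j = 1 := Matrix.det_fin_zero

theorem blockDet_one (a j : ℤ) : blockDet n lam mu α 1 a j = α (latticePoint a j) := by
  simp [blockDet, weightedGreen, green_self]

theorem blockDet_pos [LinearOrder K] [IsStrictOrderedRing K] (hlam : ∀ d, 0 < lam d)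
    (hmu : ∀ d, 0 < mu d) (hα : ∀ v, 0 < α v) (k : ℕ) (a j : ℤ) :
    0 < blockDet n lam mu α k a j := by
  induction k using Nat.twoStepInduction generalizing a j with
  | zero => simp [blockDet_zero]
  | one => simpa [blockDet_one] using hα _
  | more k ih ih' =>
    refine pos_of_mul_pos_left ?_ (ih (a + 1) (j + 1)).le
    rw [blockDet_octahedron n lam mu (fun v => (hα v).ne') fun d => (hlam d).ne']
    have := ih' a j
    have := ih' (a + 1) j
    have := ih' a (j + 1)
    have := ih' (a + 1) (j + 1)
    have := hlam (j + a + k + 2 - n)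
    have := hmu (j - a)
    positivity

theorem lambdaDet_labelBlock (hα : ∀ v, α v ≠ 0) (hlam : ∀ d, lam d ≠ 0)
    (hdet : ∀ k a j, blockDet n lam mu α k a j ≠ 0) {k : ℕ} {a j : ℤ} {lam' mu' : ℤ → K}
    (hlam' : ∀ d, lam' d = lam (d + (j + a + k - n))) (hmu' : ∀ d, mu' d = mu (d + (j - a))) :
    lambdaDet k lam' mu' (labelBlock α k a j) = blockDet n lam mu α k a j := by
  induction k using Nat.twoStepInduction generalizing a j lam' mu' with
  | zero => rw [lambdaDet, blockDet_zero]
  | one => simp [lambdaDet, blockDet_one, labelBlock]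
  | more k ih ih' =>
    have hlam_zero : lam' 0 = lam (j + a + k + 2 - n) :=
      (hlam' 0).trans (congrArg lam (by push_cast; ring))
    have hmu_zero : mu' 0 = mu (j - a) := (hmu' 0).trans (congrArg mu (by ring))
    rw [lambdaDet, labelBlock_submatrix_succ_succ, labelBlock_submatrix_castSucc_castSucc,
      labelBlock_submatrix_succ_castSucc, labelBlock_submatrix_castSucc_succ,
      labelBlock_submatrix_interior, ih, ih', ih', ih', ih', hlam_zero, hmu_zero,
      div_eq_iff (hdet _ _ _), blockDet_octahedron n lam mu hα hlam]
    all_goals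
      intro d
      first
      | exact (hlam' _).trans (congrArg lam (by push_cast; ring))
      | exact (hmu' _).trans (congrArg mu (by ring))

end Octahedron

/-! ### Path partition functions -/

section Paths

variable {n : ℕ}

theorem mem_networkVertices {v : ℤ × ℤ} :
    v ∈ networkVertices n ↔ (v.1 + v.2) % 2 = 0 ∧ 0 ≤ v.1 + v.2 ∧ v.1 + v.2 ≤ 2 * (n - 1) ∧
      0 ≤ v.2 - v.1 ∧ v.2 - v.1 ≤ 2 * (n - 1) := by
  simp only [networkVertices, Set.mem_ofPred_eq, Int.even_iff]
  rcases abs_cases v.1 with h | h <;> rcases abs_cases (v.2 - n + 1) with h' | h' <;> omega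

theorem exists_latticePoint_rev_eq {v : ℤ × ℤ} (hv : v ∈ networkVertices n) :
    ∃ i j : Fin n, latticePoint i.rev j = v := by
  rw [mem_networkVertices] at hv
  refine ⟨⟨(n - 1 - (v.2 - v.1) / 2).toNat, by omega⟩, ⟨((v.1 + v.2) / 2).toNat, by omega⟩, ?_⟩
  ext <;> simp only [latticePoint, Fin.val_rev] <;> omega

theorem IsNetPath.source_mem {u e : ℤ × ℤ} {p : List NetStep} (h : IsNetPath n u e p) :
    u ∈ networkVertices n := by
  cases p <;> exact h.1

theorem IsNetPath.length_le {u e : ℤ × ℤ} {p : List NetStep} (h : IsNetPath n u e p) :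
    p.length ≤ e.1 - u.1 := by
  induction p generalizing u with
  | nil => simp [h.2]
  | cons s p ih =>
    have hp := ih h.2
    have := s.one_le_disp_fst
    rw [Prod.fst_add] at hp
    rw [List.length_cons]
    omega

theorem finite_setOf_isNetPath (u e : ℤ × ℤ) : {p | IsNetPath n u e p}.Finite :=
  (List.finite_length_le NetStep (e.1 - u.1).toNat).subset fun p hp => by
    have := IsNetPath.length_le hp
    simp only [Set.mem_ofPred_eq]
    omega

theorem setOf_isNetPath_eq_of_mem {u e : ℤ × ℤ} (hu : u ∈ networkVertices n) :
    {p | IsNetPath n u e p} = {p | p = [] ∧ u = e} ∪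
      ⋃ s : NetStep, List.cons s '' {p | IsNetPath n (u + s.disp) e p} := by
  ext p
  cases p <;> simp [IsNetPath, hu]

variable {K : Type*} [Field K] (lam mu : ℤ → K) (α : ℤ × ℤ → K)

theorem netPartition_eq_zero {u e : ℤ × ℤ} (h : ∀ p, ¬ IsNetPath n u e p) :
    netPartition n lam mu α u e = 0 :=
  finsum_mem_eq_zero_of_forall_eq_zero fun p hp => absurd hp (h p)

theorem netPartition_eq_first_step {u : ℤ × ℤ} (hu : u ∈ networkVertices n) (e : ℤ × ℤ) :
    netPartition n lam mu α u e = (if u = e then 1 else 0) +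
      ∑ s : NetStep, s.weight n lam mu α u * netPartition n lam mu α (u + s.disp) e := by
  have hfin (s : NetStep) : (List.cons s '' {p | IsNetPath n (u + s.disp) e p}).Finite :=
    (finite_setOf_isNetPath _ _).image _
  have hnil : {p : List NetStep | p = [] ∧ u = e}.Finite :=
    (Set.finite_singleton []).subset fun p hp => hp.1
  have hdisj : Disjoint {p : List NetStep | p = [] ∧ u = e}
      (⋃ s : NetStep, List.cons s '' {p | IsNetPath n (u + s.disp) e p}) := by
    rw [Set.disjoint_left]
    rintro p ⟨rfl, -⟩
    simp
  have hpairwise : Pairwise (Function.onFun Disjoint fun s : NetStep =>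
      List.cons s '' {p | IsNetPath n (u + s.disp) e p}) := by
    intro s s' hs
    rw [Function.onFun, Set.disjoint_left]
    rintro _ ⟨p, -, rfl⟩ ⟨p', -, h⟩
    exact hs (List.cons.inj h).1.symm
  rw [netPartition, setOf_isNetPath_eq_of_mem hu,
    finsum_mem_union hdisj hnil (Set.finite_iUnion hfin), finsum_mem_iUnion hpairwise hfin]
  congr 1
  · split_ifs with h
    · simp only [h, and_true, Set.ofPred_eq_eq_singleton]
      rw [finsum_mem_singleton]
      rfl
    · simp [h]
  · refine (finsum_eq_sum_of_fintype _).trans (Finset.sum_congr rfl fun s _ => ?_)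
    rw [finsum_mem_image List.cons_injective.injOn, netPartition,
      mul_finsum_mem]
    rfl

theorem green_eq_zero_of_leaves_network {u e : ℤ × ℤ} (hu : u ∈ networkVertices n)
    (he : e ∈ networkVertices n) {s : NetStep} (hs : u + s.disp ∉ networkVertices n) :
    green n lam mu α (u + s.disp) e = 0 := by
  apply green_eq_zero
  rw [mem_networkVertices] at hu he hs
  rw [lt_abs]
  cases s <;> simp only [NetStep.disp, Prod.fst_add, Prod.snd_add] at hs ⊢ <;> omega

theorem netPartition_eq_green {u e : ℤ × ℤ} (hu : u ∈ networkVertices n)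
    (he : e ∈ networkVertices n) : netPartition n lam mu α u e = green n lam mu α u e := by
  obtain ⟨m, hm⟩ : ∃ m : ℕ, e.1 - u.1 < m := ⟨(e.1 - u.1 + 1).toNat, by omega⟩
  induction m generalizing u with
  | zero =>
    rw [netPartition_eq_zero, green_eq_zero]
    · have := abs_nonneg (e.2 - u.2)
      omega
    · intro p hp
      have := hp.length_le
      omega
  | succ m ih =>
    rw [netPartition_eq_first_step lam mu α hu, green_eq_first_step]
    congr 1
    refine Finset.sum_congr rfl fun s _ => congrArg _ ?_
    by_cases hs : u + s.disp ∈ networkVertices n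
    · have := s.one_le_disp_fst
      exact ih hs (by rw [Prod.fst_add]; omega)
    · rw [green_eq_zero_of_leaves_network lam mu α hu he hs,
        netPartition_eq_zero lam mu α fun p hp => hs hp.source_mem]

variable {lam mu α} {α' : ℤ × ℤ → K}

theorem IsNetPath.weight_congr (hα : ∀ v ∈ networkVertices n, α v = α' v) {u e : ℤ × ℤ}
    {p : List NetStep} (h : IsNetPath n u e p) :
    netPathWeight n lam mu α u p = netPathWeight n lam mu α' u p := by
  induction p generalizing u with
  | nil => rfl
  | cons s p ih =>
    have hlabel : s ≠ .up → α (u + (1, -1)) = α' (u + (1, -1)) := fun hs => by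
      refine hα _ ?_
      have hu := h.1
      have hv := h.2.source_mem
      rw [mem_networkVertices] at hu hv ⊢
      cases s with
      | up => exact absurd rfl hs
      | flat | down => simp only [NetStep.disp, Prod.fst_add, Prod.snd_add] at hv ⊢; omega
    have hstep : s.weight n lam mu α u = s.weight n lam mu α' u := by
      cases s <;> simp only [NetStep.weight, hα u h.1, hlabel, ne_eq, reduceCtorEq,
        not_false_eq_true]
    rw [netPathWeight, netPathWeight, hstep, ih h.2]

theorem green_congr (hα : ∀ v ∈ networkVertices n, α v = α' v) {u e : ℤ × ℤ}
    (hu : u ∈ networkVertices n) (he : e ∈ networkVertices n) :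
    green n lam mu α u e = green n lam mu α' u e := by
  rw [← netPartition_eq_green lam mu α hu he, ← netPartition_eq_green lam mu α' hu he]
  exact finsum_mem_congr rfl fun p hp => IsNetPath.weight_congr hα hp

theorem source_mem_networkVertices (i : Fin n) : latticePoint i 0 ∈ networkVertices n := by
  have := i.isLt
  rw [mem_networkVertices]
  simp only [latticePoint]
  omega

theorem target_mem_networkVertices (j : Fin n) : latticePoint 0 j ∈ networkVertices n := by
  have := j.isLt
  rw [mem_networkVertices]
  simp only [latticePoint]
  omega

theorem blockDet_congr (hα : ∀ v ∈ networkVertices n, α v = α' v) :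
    blockDet n lam mu α n 0 0 = blockDet n lam mu α' n 0 0 := by
  refine congrArg Matrix.det (Matrix.ext fun i j => ?_)
  simp only [Matrix.of_apply, zero_add, weightedGreen]
  rw [hα _ (target_mem_networkVertices j),
    green_congr hα (source_mem_networkVertices i) (target_mem_networkVertices j)]

end Paths
/-! ### Values of rational functions at a point -/

section Values

variable {σ K : Type*} [Field K] {p : σ → K}

theorem hasValueAt_algebraMap (P : MvPolynomial σ ℤ) :
    HasValueAt (algebraMap _ (FractionRing (MvPolynomial σ ℤ)) P) p (MvPolynomial.aeval p P) :=
  ⟨P, 1, by simp, by simp, by simp⟩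

theorem hasValueAt_X (x : σ) :
    HasValueAt (algebraMap (MvPolynomial σ ℤ) (FractionRing (MvPolynomial σ ℤ))
      (MvPolynomial.X x)) p (p x) := by
  simpa using hasValueAt_algebraMap (p := p) (MvPolynomial.X x)

theorem hasValueAt_zero : HasValueAt (0 : FractionRing (MvPolynomial σ ℤ)) p 0 := by
  simpa using hasValueAt_algebraMap (p := p) 0

theorem hasValueAt_one : HasValueAt (1 : FractionRing (MvPolynomial σ ℤ)) p 1 := by
  simpa using hasValueAt_algebraMap (p := p) 1

section Operations

variable {f g : FractionRing (MvPolynomial σ ℤ)} {d e : K}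

theorem HasValueAt.add (hf : HasValueAt f p d) (hg : HasValueAt g p e) :
    HasValueAt (f + g) p (d + e) := by
  obtain ⟨N, D, hD, hfN, hdN⟩ := hf
  obtain ⟨N', D', hD', hgN', heN'⟩ := hg
  refine ⟨N * D' + N' * D, D * D', by simp [hD, hD'], ?_, ?_⟩
  · simp only [map_mul, map_add, ← hfN, ← hgN']
    ring
  · simp only [map_mul, map_add, ← hdN, ← heN']
    ring

theorem HasValueAt.mul (hf : HasValueAt f p d) (hg : HasValueAt g p e) :
    HasValueAt (f * g) p (d * e) := by
  obtain ⟨N, D, hD, hfN, hdN⟩ := hf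
  obtain ⟨N', D', hD', hgN', heN'⟩ := hg
  refine ⟨N * N', D * D', by simp [hD, hD'], ?_, ?_⟩
  · simp only [map_mul, ← hfN, ← hgN']
    ring
  · simp only [map_mul, ← hdN, ← heN']
    ring

theorem HasValueAt.neg (hf : HasValueAt f p d) : HasValueAt (-f) p (-d) := by
  obtain ⟨N, D, hD, hfN, hdN⟩ := hf
  exact ⟨-N, D, hD, by simp [hfN], by simp [hdN]⟩

theorem HasValueAt.div (hf : HasValueAt f p d) (hg : HasValueAt g p e) (he : e ≠ 0) :
    HasValueAt (f / g) p (d / e) := by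
  obtain ⟨N, D, hD, hfN, hdN⟩ := hf
  obtain ⟨N', D', hD', hgN', heN'⟩ := hg
  have hN' : MvPolynomial.aeval p N' ≠ 0 := heN' ▸ mul_ne_zero he hD'
  have hg0 : g ≠ 0 := by
    rintro rfl
    rw [zero_mul, eq_comm, FaithfulSMul.algebraMap_eq_zero_iff] at hgN'
    simp [hgN'] at hN'
  refine ⟨N * D', D * N', by simp [hD, hN'], ?_, ?_⟩
  · simp only [map_mul, ← hfN, ← hgN']
    field_simp
  · simp only [map_mul, ← hdN, ← heN']
    field_simp

theorem HasValueAt.unique (hd : HasValueAt f p d) (he : HasValueAt f p e) : d = e := by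
  obtain ⟨N, D, hD, hfN, hdN⟩ := hd
  obtain ⟨N', D', hD', hfN', heN'⟩ := he
  have hcross : N * D' = N' * D := by
    apply FaithfulSMul.algebraMap_injective (MvPolynomial σ ℤ) (FractionRing (MvPolynomial σ ℤ))
    simp only [map_mul, ← hfN, ← hfN']
    ring
  have hvalue := congrArg (MvPolynomial.aeval p) hcross
  simp only [map_mul, ← hdN, ← heN'] at hvalue
  apply mul_right_cancel₀ (mul_ne_zero hD hD')
  linear_combination hvalue

end Operations

/-- The graph of evaluation at `p`: the pairs of a rational function regular at `p` and its value.
Working inside this ring transports polynomial identities to values. -/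
def valueSubring (p : σ → K) : Subring (FractionRing (MvPolynomial σ ℤ) × K) where
  carrier := {x | HasValueAt x.1 p x.2}
  mul_mem' h h' := HasValueAt.mul h h'
  one_mem' := hasValueAt_one
  add_mem' h h' := HasValueAt.add h h'
  zero_mem' := hasValueAt_zero
  neg_mem' h := HasValueAt.neg h

theorem HasValueAt.sum {ι : Type*} {s : Finset ι} {f : ι → FractionRing (MvPolynomial σ ℤ)}
    {d : ι → K} (h : ∀ i ∈ s, HasValueAt (f i) p (d i)) :
    HasValueAt (∑ i ∈ s, f i) p (∑ i ∈ s, d i) := by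
  have hmem : ∑ i ∈ s, (f i, d i) ∈ valueSubring p := Subring.sum_mem _ h
  rwa [← prod_mk_sum] at hmem

theorem HasValueAt.det {k : ℕ} {M : Matrix (Fin k) (Fin k) (FractionRing (MvPolynomial σ ℤ))}
    {M' : Matrix (Fin k) (Fin k) K} (h : ∀ i j, HasValueAt (M i j) p (M' i j)) :
    HasValueAt M.det p M'.det := by
  let Q : Matrix (Fin k) (Fin k) (valueSubring p) := fun i j => ⟨(M i j, M' i j), h i j⟩
  have hfst : Q.det.1.1 = M.det :=
    RingHom.map_det ((RingHom.fst _ K).comp (valueSubring p).subtype) Q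
  have hsnd : Q.det.1.2 = M'.det :=
    RingHom.map_det ((RingHom.snd (FractionRing (MvPolynomial σ ℤ)) K).comp
      (valueSubring p).subtype) Q
  rw [← hfst, ← hsnd]
  exact Q.det.2

variable {n : ℕ} {lam mu : ℤ → FractionRing (MvPolynomial σ ℤ)}
  {α : ℤ × ℤ → FractionRing (MvPolynomial σ ℤ)} {lam' mu' : ℤ → K} {α' : ℤ × ℤ → K}

theorem hasValueAt_weight (hlam : ∀ d, HasValueAt (lam d) p (lam' d))
    (hmu : ∀ d, HasValueAt (mu d) p (mu' d)) (hα : ∀ v, HasValueAt (α v) p (α' v))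
    (hα' : ∀ v, α' v ≠ 0) (u : ℤ × ℤ) (s : NetStep) :
    HasValueAt (s.weight n lam mu α u) p (s.weight n lam' mu' α' u) := by
  have hdiv := (hα u).div (hα (u + (1, -1))) (hα' _)
  cases s with
  | up => exact hlam _
  | flat => exact (hmu _).mul hdiv
  | down => exact hdiv

theorem hasValueAt_green (hlam : ∀ d, HasValueAt (lam d) p (lam' d))
    (hmu : ∀ d, HasValueAt (mu d) p (mu' d)) (hα : ∀ v, HasValueAt (α v) p (α' v))
    (hα' : ∀ v, α' v ≠ 0) (u v : ℤ × ℤ) :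
    HasValueAt (green n lam mu α u v) p (green n lam' mu' α' u v) := by
  obtain ⟨m, hm⟩ : ∃ m : ℕ, v.1 - u.1 < m := ⟨(v.1 - u.1 + 1).toNat, by omega⟩
  induction m generalizing u with
  | zero =>
    have h : v.1 - u.1 < |v.2 - u.2| := hm.trans_le (by simp)
    rw [green_eq_zero n lam mu α h, green_eq_zero n lam' mu' α' h]
    exact hasValueAt_zero
  | succ m ih =>
    rw [green_eq_first_step n lam, green_eq_first_step n lam']
    refine HasValueAt.add ?_ (HasValueAt.sum fun s _ =>
      (hasValueAt_weight hlam hmu hα hα' u s).mul (ih _ ?_))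
    · split_ifs
      exacts [hasValueAt_one, hasValueAt_zero]
    · have := s.one_le_disp_fst
      rw [Prod.fst_add]
      omega

theorem hasValueAt_blockDet (hlam : ∀ d, HasValueAt (lam d) p (lam' d))
    (hmu : ∀ d, HasValueAt (mu d) p (mu' d)) (hα : ∀ v, HasValueAt (α v) p (α' v))
    (hα' : ∀ v, α' v ≠ 0) (k : ℕ) (a j : ℤ) :
    HasValueAt (blockDet n lam mu α k a j) p (blockDet n lam' mu' α' k a j) :=
  HasValueAt.det fun _ _ => (hα _).mul (hasValueAt_green hlam hmu hα hα' _ _)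

theorem hasValueAt_lambdaDet {A : Matrix (Fin n) (Fin n) (FractionRing (MvPolynomial σ ℤ))}
    {A' : Matrix (Fin n) (Fin n) K} (hlam : ∀ d, HasValueAt (lam d) p (lam' d))
    (hmu : ∀ d, HasValueAt (mu d) p (mu' d)) (hA : ∀ i j, HasValueAt (A i j) p (A' i j))
    (hdef : CondensationDefined n lam' mu' A') :
    HasValueAt (lambdaDet n lam mu A) p (lambdaDet n lam' mu' A') := by
  induction n using Nat.twoStepInduction generalizing lam mu lam' mu' with
  | zero => exact hasValueAt_one
  | one => exact hA 0 0
  | more n ih ih' =>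
    obtain ⟨hss, hcc, hsc, hcs, hinner, hne⟩ := hdef
    rw [lambdaDet, lambdaDet]
    exact ((((hmu 0).mul (ih' hlam (fun _ => hmu _) (fun _ _ => hA _ _) hss)).mul
      (ih' hlam (fun _ => hmu _) (fun _ _ => hA _ _) hcc)).add
      (((hlam 0).mul (ih' (fun _ => hlam _) hmu (fun _ _ => hA _ _) hsc)).mul
      (ih' (fun _ => hlam _) hmu (fun _ _ => hA _ _) hcs))).div
      (ih hlam hmu (fun _ _ => hA _ _) hinner) hne

end Values

/-! ### Specialization of the generic matrix -/

section Specialization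

section Extension

variable {n : ℕ} {X : Type*} [One X]

/-- The labelling of the lattice by the entries of `A` at the vertices of the network, and by `1`
elsewhere. -/
noncomputable def extendEntries (A : Matrix (Fin n) (Fin n) X) : ℤ × ℤ → X :=
  Function.extend (fun q : Fin n × Fin n => latticePoint q.1.rev q.2) (fun q => A q.1 q.2) 1

theorem extendEntries_latticePoint_rev (A : Matrix (Fin n) (Fin n) X) (i j : Fin n) :
    extendEntries A (latticePoint i.rev j) = A i j := by
  have hinj : (fun q : Fin n × Fin n => latticePoint q.1.rev q.2).Injective := by
    rintro ⟨i, j⟩ ⟨i', j'⟩ h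
    simp only [latticePoint, Fin.val_rev, Prod.mk.injEq] at h
    ext <;> simp only <;> omega
  exact hinj.extend_apply _ _ (i, j)

theorem extendEntries_eq_one (A : Matrix (Fin n) (Fin n) X) {v : ℤ × ℤ}
    (hv : ¬ ∃ i j : Fin n, latticePoint i.rev j = v) : extendEntries A v = 1 :=
  Function.extend_apply' _ _ _ fun ⟨q, hq⟩ => hv ⟨q.1, q.2, hq⟩

theorem extendEntries_mem {s : Set X} (hs : 1 ∈ s) {A : Matrix (Fin n) (Fin n) X}
    (hA : ∀ i j, A i j ∈ s) (v : ℤ × ℤ) : extendEntries A v ∈ s := by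
  by_cases hv : ∃ i j : Fin n, latticePoint i.rev j = v
  · obtain ⟨i, j, rfl⟩ := hv
    rw [extendEntries_latticePoint_rev]
    exact hA i j
  · rwa [extendEntries_eq_one A hv]

theorem labelBlock_extendEntries (A : Matrix (Fin n) (Fin n) X) :
    labelBlock (extendEntries A) n 0 0 = A := by
  ext i j
  simp only [labelBlock, Matrix.of_apply, zero_add, extendEntries_latticePoint_rev]

end Extension

theorem hasValueAt_extendEntries {σ K : Type*} [Field K] {p : σ → K} {n : ℕ}
    {B : Matrix (Fin n) (Fin n) (FractionRing (MvPolynomial σ ℤ))} {A : Matrix (Fin n) (Fin n) K}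
    (h : ∀ i j, HasValueAt (B i j) p (A i j)) (v : ℤ × ℤ) :
    HasValueAt (extendEntries B v) p (extendEntries A v) := by
  by_cases hv : ∃ i j : Fin n, latticePoint i.rev j = v
  · obtain ⟨i, j, rfl⟩ := hv
    rw [extendEntries_latticePoint_rev, extendEntries_latticePoint_rev]
    exact h i j
  · rw [extendEntries_eq_one B hv, extendEntries_eq_one A hv]
    exact hasValueAt_one

/-- The sequence of indeterminates `λ_a`. -/
noncomputable def genericLam (n : ℕ) (a : ℤ) : LambdaField n :=
  algebraMap (MvPolynomial (LambdaVar n) ℤ) (LambdaField n) (MvPolynomial.X (Sum.inr (Sum.inl a)))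

/-- The sequence of indeterminates `μ_a`. -/
noncomputable def genericMu (n : ℕ) (a : ℤ) : LambdaField n :=
  algebraMap (MvPolynomial (LambdaVar n) ℤ) (LambdaField n) (MvPolynomial.X (Sum.inr (Sum.inr a)))

/-- The matrix of indeterminates. -/
noncomputable def genericMatrix (n : ℕ) : Matrix (Fin n) (Fin n) (LambdaField n) :=
  .of fun i j => algebraMap (MvPolynomial (LambdaVar n) ℤ) (LambdaField n)
    (MvPolynomial.X (Sum.inl (i, j)))

theorem genericVar_ne_zero (n : ℕ) (x : LambdaVar n) :
    algebraMap (MvPolynomial (LambdaVar n) ℤ) (LambdaField n) (MvPolynomial.X x) ≠ 0 :=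
  (FaithfulSMul.algebraMap_eq_zero_iff _ _).not.2 (MvPolynomial.X_ne_zero x)

variable {K : Type*} [Field K] {n : ℕ}

theorem hasValueAt_blockDet_generic (lam mu : ℤ → K) {A : Matrix (Fin n) (Fin n) K}
    (hA : ∀ i j, A i j ≠ 0) (k : ℕ) (a j : ℤ) :
    HasValueAt (blockDet n (genericLam n) (genericMu n) (extendEntries (genericMatrix n)) k a j)
      (lambdaPoint n lam mu A) (blockDet n lam mu (extendEntries A) k a j) :=
  hasValueAt_blockDet (fun _ => hasValueAt_X _) (fun _ => hasValueAt_X _)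
    (hasValueAt_extendEntries fun _ _ => hasValueAt_X _)
    (extendEntries_mem (s := {0}ᶜ) one_ne_zero hA) k a j

theorem blockDet_generic_ne_zero (k : ℕ) (a j : ℤ) :
    blockDet n (genericLam n) (genericMu n) (extendEntries (genericMatrix n)) k a j ≠ 0 := by
  let E : Matrix (Fin n) (Fin n) ℚ := .of fun _ _ => 1
  have hpos : ∀ v, 0 < extendEntries E v :=
    extendEntries_mem (s := Set.Ioi 0) (A := E) one_pos fun _ _ => one_pos (α := ℚ)
  intro hzero
  have hvalue := hasValueAt_blockDet_generic (fun _ => (1 : ℚ)) (fun _ => 1) (A := E)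
    (fun _ _ => one_ne_zero) k a j
  rw [hzero] at hvalue
  exact (blockDet_pos n _ _ (fun _ => one_pos) (fun _ => one_pos) hpos k a j).ne
    (hasValueAt_zero.unique hvalue)

theorem genericLambdaDet_eq_blockDet :
    genericLambdaDet n =
      blockDet n (genericLam n) (genericMu n) (extendEntries (genericMatrix n)) n 0 0 := by
  have hne : ∀ v, extendEntries (genericMatrix n) v ≠ 0 :=
    extendEntries_mem (s := {0}ᶜ) (A := genericMatrix n) one_ne_zero
      fun _ _ => genericVar_ne_zero n _
  rw [← lambdaDet_labelBlock n (genericLam n) (genericMu n) (lam' := genericLam n)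
    (mu' := genericMu n) hne (fun _ => genericVar_ne_zero n _) blockDet_generic_ne_zero
    (by simp) (by simp), labelBlock_extendEntries]
  rfl

variable {A : Matrix (Fin n) (Fin n) K} {α : ℤ × ℤ → K}

theorem hasValueAt_genericLambdaDet (lam mu : ℤ → K) (hα0 : ∀ v, α v ≠ 0)
    (hα : ∀ i j : Fin n, α (latticePoint i.rev j) = A i j) :
    HasValueAt (genericLambdaDet n) (lambdaPoint n lam mu A) (blockDet n lam mu α n 0 0) := by
  have hext : ∀ v ∈ networkVertices n, α v = extendEntries A v := by
    intro v hv
    obtain ⟨i, j, rfl⟩ := exists_latticePoint_rev_eq hv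
    rw [hα, extendEntries_latticePoint_rev]
  rw [genericLambdaDet_eq_blockDet, blockDet_congr hext]
  exact hasValueAt_blockDet_generic lam mu (fun i j => hα i j ▸ hα0 _) n 0 0

theorem lambdaDet_eq_blockDet {lam mu : ℤ → K} (hα0 : ∀ v, α v ≠ 0)
    (hα : ∀ i j : Fin n, α (latticePoint i.rev j) = A i j) (hdef : CondensationDefined n lam mu A) :
    lambdaDet n lam mu A = blockDet n lam mu α n 0 0 :=
  HasValueAt.unique (p := lambdaPoint n lam mu A)
    (hasValueAt_lambdaDet (fun _ => hasValueAt_X _) (fun _ => hasValueAt_X _)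
      (fun _ _ => hasValueAt_X _) hdef)
    (hasValueAt_genericLambdaDet lam mu hα0 hα)

end Specialization

/-! ### Matrix elements in operator form -/

section Translations

variable (K : Type*) [Field K]

theorem latticeTranslate_zpow (d : ℤ × ℤ) (a : ℤ) :
    latticeTranslate K d ^ a = latticeTranslate K (a • d) := by
  let φ : Multiplicative (ℤ × ℤ) →* (LatticeSpace K ≃ₗ[K] LatticeSpace K) :=
    { toFun := fun d => latticeTranslate K d.toAdd
      map_one' := by
        ext f v
        exact congrArg f.1 (sub_zero v)
      map_mul' := fun d e => by
        ext f v
        exact congrArg f.1 (sub_sub v d.toAdd e.toAdd).symm }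
  exact (map_zpow φ (Multiplicative.ofAdd d) a).symm

theorem latticeTranslate_ket (d u : ℤ × ℤ) :
    latticeTranslate K d (ket K u) = ket K (u + d) := by
  ext v
  change (ket K u).1 (v - d) = (ket K (u + d)).1 v
  simp only [ket_apply, eq_sub_iff_add_eq]

theorem zOp_zpow_ket (i : ℤ) : (zOp K ^ (1 - (i + 1))) (ket K (0, 0)) = ket K (-i, i) := by
  rw [zOp, latticeTranslate_zpow, latticeTranslate_ket]
  congr 1
  ext <;> simp

theorem bra_wOp_zpow (j : ℤ) (f : LatticeSpace K) :
    bra K (0, 0) ((wOp K ^ (1 - (j + 1))) f) = bra K (j, j) f := by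
  rw [wOp, latticeTranslate_zpow]
  refine congrArg f.1 ?_
  ext <;> simp

theorem det_resolvent_eq_blockDet {K : Type*} [Field K] (n : ℕ) (lam mu : ℤ → K)
    (α : ℤ × ℤ → K) :
    (Matrix.of fun i j : Fin n =>
      bra K (0, 0) ((wOp K ^ (1 - ((j : ℤ) + 1)))
        (diagOp α (Ring.inverse (1 - transferOp n lam mu α)
          ((zOp K ^ (1 - ((i : ℤ) + 1))) (ket K (0, 0))))))).det =
      blockDet n lam mu α n 0 0 := by
  refine congrArg Matrix.det (Matrix.ext fun i j => ?_)
  simp only [Matrix.of_apply, zOp_zpow_ket, bra_wOp_zpow, latticePoint, zero_add, zero_sub,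
    sub_zero, add_zero]
  rfl

end Translations

/-- The indices `i j : Fin n` stand for the indices `i + 1`, `j + 1` in `{1, …, n}`. The function
`α` is any nowhere vanishing function on `ℤ²` that labels each vertex of `networkVertices n` by the
corresponding entry of `A`. -/
theorem mainTheorem7 {K : Type*} [Field K] (n : ℕ) (lam mu : ℤ → K)
    (A : Matrix (Fin n) (Fin n) K) (α : ℤ × ℤ → K)
    (hα0 : ∀ v, α v ≠ 0)
    (hα : ∀ i j : Fin n, α ((i : ℤ) + j + 1 - n, (j : ℤ) - i + n - 1) = A i j) :
    IsUnit (1 - transferOp n lam mu α) ∧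
    (∀ i j : Fin n,
      {p | IsNetPath n (-(i : ℤ), (i : ℤ)) ((j : ℤ), (j : ℤ)) p}.Finite ∧
      netPartition n lam mu α (-(i : ℤ), (i : ℤ)) ((j : ℤ), (j : ℤ)) =
        bra K (0, 0) ((wOp K ^ (1 - ((j : ℤ) + 1)))
          (Ring.inverse (1 - transferOp n lam mu α)
            ((zOp K ^ (1 - ((i : ℤ) + 1))) (ket K (0, 0)))))) ∧
    (CondensationDefined n lam mu A →
      lambdaDet n lam mu A =
        (Matrix.of fun i j : Fin n =>
          bra K (0, 0) ((wOp K ^ (1 - ((j : ℤ) + 1)))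
            (diagOp α (Ring.inverse (1 - transferOp n lam mu α)
              ((zOp K ^ (1 - ((i : ℤ) + 1))) (ket K (0, 0))))))).det) ∧
    HasValueAt (genericLambdaDet n) (lambdaPoint n lam mu A)
      (Matrix.of fun i j : Fin n =>
        bra K (0, 0) ((wOp K ^ (1 - ((j : ℤ) + 1)))
          (diagOp α (Ring.inverse (1 - transferOp n lam mu α)
            ((zOp K ^ (1 - ((i : ℤ) + 1))) (ket K (0, 0))))))).det := by
  have hα' (i j : Fin n) : α (latticePoint i.rev j) = A i j := by
    refine (congrArg α ?_).trans (hα i j)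
    simp only [latticePoint, Fin.val_rev, Prod.mk.injEq]
    omega
  rw [det_resolvent_eq_blockDet]
  refine ⟨isUnit_one_sub_transferOp n lam mu α, fun i j => ⟨finite_setOf_isNetPath _ _, ?_⟩,
    lambdaDet_eq_blockDet hα0 hα', hasValueAt_genericLambdaDet lam mu hα0 hα'⟩
  have hsource : latticePoint i 0 = (-(i : ℤ), (i : ℤ)) := by simp [latticePoint]
  have htarget : latticePoint 0 j = ((j : ℤ), (j : ℤ)) := by simp [latticePoint]
  rw [zOp_zpow_ket, bra_wOp_zpow, ← hsource, ← htarget]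
  exact netPartition_eq_green lam mu α (source_mem_networkVertices i)
    (target_mem_networkVertices j)
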